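/- Let $S^1=\mathbb{R}/2\pi\mathbb{Z}$ and let $S^2\subset\mathbb{R}^3$ be the unit sphere. For $\theta\in S^1$ let $r_\theta\colon S^2\to S^2$ be the rotation about the $x_3$-axis through the angle $\theta$, and define the diffeomorphism $r$ of $S^1\times S^2$ by $r(\theta,\mathbf{x})=(\theta,r_\theta(\mathbf{x}))$. For a smooth manifold $M$, let $\mathcal{D}(M)=\mathrm{Diff}(M)/\mathrm{Diff}_0(M)$ be the diffeotopy group, that is, the quotient of the group $\mathrm{Diff}(M)$ of all smooth diffeomorphisms of $M$ by the normal subgroup $\mathrm{Diff}_0(M)$ of diffeomorphisms that are smoothly isotopic to the identity. Then the class $[r]$ has order exactly $2$ in $\mathcal{D}(S^1\times S^2)$. -/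

import Mathlib

open scoped Manifold ContDiff

noncomputable section

section Diffeotopy

variable {E : Type*} [NormedAddCommGroup E] [NormedSpace ℝ E]
  {H : Type*} [TopologicalSpace H] (I : ModelWithCorners ℝ E H)
  (M : Type*) [TopologicalSpace M] [ChartedSpace H M]

/-- `Diff(M)`, the group of smooth diffeomorphisms of `M` under composition. -/
abbrev Diff : Type _ := M ≃ₘ⟮I, I⟯ M

variable {I M}

instance instGroupDiff : Group (Diff I M) where
  mul f g := g.trans f
  one := Diffeomorph.refl I M ∞
  inv f := f.symm
  mul_assoc _ _ _ := rfl
  one_mul _ := rfl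
  mul_one _ := rfl
  inv_mul_cancel f := f.self_trans_symm

/-- Two diffeomorphisms of `M` are isotopic if they are joined by a family `φ t`, `t ∈ [0, 1]`, of
diffeomorphisms which is smooth together with its inverse family, that is, such that
`(t, x) ↦ (t, φ t x)` is a level-preserving diffeomorphism of `[0, 1] × M`. -/
def Isotopic (f g : Diff I M) : Prop :=
  ∃ φ : Set.Icc (0 : ℝ) 1 → Diff I M,
    ContMDiff ((𝓡∂ 1).prod I) I ∞ (fun p : Set.Icc (0 : ℝ) 1 × M => φ p.1 p.2) ∧
    ContMDiff ((𝓡∂ 1).prod I) I ∞ (fun p : Set.Icc (0 : ℝ) 1 × M => (φ p.1).symm p.2) ∧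
    φ 0 = f ∧ φ 1 = g

variable (I M)

/-- `Diff₀(M)`, the subgroup of the diffeomorphisms isotopic to the identity. -/
def Diff₀ : Subgroup (Diff I M) where
  carrier := {f | Isotopic 1 f}
  one_mem' := ⟨fun _ => 1, contMDiff_snd, contMDiff_snd, rfl, rfl⟩
  mul_mem' := by
    rintro f g ⟨φ, hφ, hφ', h0, h1⟩ ⟨ψ, hψ, hψ', k0, k1⟩
    refine ⟨fun t => φ t * ψ t, ?_, ?_, ?_, ?_⟩
    · exact hφ.comp (contMDiff_fst.prodMk hψ)
    · exact hψ'.comp (contMDiff_fst.prodMk hφ')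
    · simp [h0, k0]
    · simp [h1, k1]
  inv_mem' := by
    rintro f ⟨φ, hφ, hφ', h0, h1⟩
    refine ⟨fun t => (φ t)⁻¹, hφ', hφ, ?_, ?_⟩
    · simp [h0]
    · simp [h1]

instance instNormalDiff₀ : (Diff₀ I M).Normal where
  conj_mem := by
    rintro f ⟨φ, hφ, hφ', h0, h1⟩ g
    refine ⟨fun t => g * φ t * g⁻¹, ?_, ?_, ?_, ?_⟩
    · exact g.contMDiff.comp
        (hφ.comp (contMDiff_fst.prodMk (g.symm.contMDiff.comp contMDiff_snd)))
    · exact g.contMDiff.comp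
        (hφ'.comp (contMDiff_fst.prodMk (g.symm.contMDiff.comp contMDiff_snd)))
    · simp [h0]
    · simp [h1]

/-- The diffeotopy group `𝒟(M) = Diff(M) / Diff₀(M)`. -/
abbrev DiffeotopyGroup : Type _ := Diff I M ⧸ Diff₀ I M

end Diffeotopy

/-- The unit sphere in Euclidean `3`-space. -/
abbrev S2 : Type := Metric.sphere (0 : EuclideanSpace ℝ (Fin 3)) 1

/-- The linear map of `ℝ³` that rotates about the `x₃`-axis through the angle `θ`, where
`z = exp (iθ)`, so `cos θ = re z` and `sin θ = im z`. -/
def rotVec (z : Circle) (x : EuclideanSpace ℝ (Fin 3)) : EuclideanSpace ℝ (Fin 3) :=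
  !₂[(z : ℂ).re * x 0 - (z : ℂ).im * x 1, (z : ℂ).im * x 0 + (z : ℂ).re * x 1, x 2]

theorem rotVec_exp (θ : ℝ) (x : EuclideanSpace ℝ (Fin 3)) :
    rotVec (Circle.exp θ) x =
      !₂[Real.cos θ * x 0 - Real.sin θ * x 1, Real.sin θ * x 0 + Real.cos θ * x 1, x 2] := by
  simp [rotVec, Circle.coe_exp, Complex.exp_ofReal_mul_I_re, Complex.exp_ofReal_mul_I_im]

theorem circle_re_sq_add_im_sq (z : Circle) : (z : ℂ).re ^ 2 + (z : ℂ).im ^ 2 = 1 := by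
  have h := Circle.normSq_coe z
  rw [Complex.normSq_apply] at h
  nlinarith

theorem rotVec_mem (z : Circle) (x : S2) :
    rotVec z x ∈ Metric.sphere (0 : EuclideanSpace ℝ (Fin 3)) 1 := by
  have hx : ‖(x : EuclideanSpace ℝ (Fin 3))‖ = 1 := norm_eq_of_mem_sphere x
  have hz := circle_re_sq_add_im_sq z
  rw [EuclideanSpace.norm_eq, Real.sqrt_eq_one, Fin.sum_univ_three] at hx
  simp only [Real.norm_eq_abs, sq_abs] at hx
  rw [mem_sphere_zero_iff_norm, EuclideanSpace.norm_eq, Real.sqrt_eq_one, Fin.sum_univ_three]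
  simp only [Real.norm_eq_abs, sq_abs, rotVec, PiLp.toLp_apply, Matrix.cons_val]
  linear_combination hx + (x.1 0 ^ 2 + x.1 1 ^ 2) * hz

theorem rotVec_rotVec_inv (z : Circle) (x : EuclideanSpace ℝ (Fin 3)) :
    rotVec z (rotVec z⁻¹ x) = x := by
  have hz := circle_re_sq_add_im_sq z
  ext i
  fin_cases i
  · simp [rotVec]
    linear_combination x 0 * hz
  · simp [rotVec]
    linear_combination x 1 * hz
  · simp [rotVec]

/-- The rotation `r_θ` of `S²` about the `x₃`-axis through the angle `θ`, where `z = exp (iθ)`. -/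
def rotS2 (z : Circle) (x : S2) : S2 := ⟨rotVec z x, rotVec_mem z x⟩

theorem rotS2_rotS2_inv (z : Circle) (x : S2) : rotS2 z (rotS2 z⁻¹ x) = x :=
  Subtype.ext (rotVec_rotVec_inv z x)

theorem contMDiff_circle_coe :
    ContMDiff (𝓡 1) 𝓘(ℝ, ℂ) ∞ (fun z : Circle => (z : ℂ)) := by
  have := finrank_real_complex_fact'
  exact contMDiff_coe_sphere (E := ℂ)

theorem contMDiff_rotS2 :
    ContMDiff ((𝓡 1).prod (𝓡 2)) (𝓡 2) ∞ (fun p : Circle × S2 => rotS2 p.1 p.2) := by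
  have h : ContDiff ℝ ∞ (fun q : ℂ × EuclideanSpace ℝ (Fin 3) =>
      (!₂[q.1.re * q.2 0 - q.1.im * q.2 1, q.1.im * q.2 0 + q.1.re * q.2 1, q.2 2] :
        EuclideanSpace ℝ (Fin 3))) := by
    have hre : ContDiff ℝ ∞ (fun q : ℂ × EuclideanSpace ℝ (Fin 3) => q.1.re) :=
      Complex.reCLM.contDiff.comp contDiff_fst
    have him : ContDiff ℝ ∞ (fun q : ℂ × EuclideanSpace ℝ (Fin 3) => q.1.im) :=
      Complex.imCLM.contDiff.comp contDiff_fst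
    have hc : ∀ i, ContDiff ℝ ∞ (fun q : ℂ × EuclideanSpace ℝ (Fin 3) => q.2 i) := fun i =>
      (EuclideanSpace.proj (𝕜 := ℝ) i).contDiff.comp contDiff_snd
    rw [contDiff_euclidean]
    intro i
    fin_cases i
    · exact (hre.mul (hc 0)).sub (him.mul (hc 1))
    · exact (him.mul (hc 0)).add (hre.mul (hc 1))
    · exact hc 2
  have : Fact (Module.finrank ℝ (EuclideanSpace ℝ (Fin 3)) = 2 + 1) :=
    ⟨finrank_euclideanSpace_fin⟩
  have h1 : ContMDiff ((𝓡 1).prod (𝓡 2)) 𝓘(ℝ, ℂ) ∞ (fun p : Circle × S2 => (p.1 : ℂ)) :=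
    contMDiff_circle_coe.comp contMDiff_fst
  have h2 : ContMDiff ((𝓡 1).prod (𝓡 2)) 𝓘(ℝ, EuclideanSpace ℝ (Fin 3)) ∞
      (fun p : Circle × S2 => (p.2 : EuclideanSpace ℝ (Fin 3))) :=
    contMDiff_coe_sphere.comp contMDiff_snd
  exact (h.contMDiff.comp (h1.prodMk_space h2)).codRestrict_sphere
    (fun p => rotVec_mem p.1 p.2)

/-- The diffeomorphism `r(θ, x) = (θ, r_θ(x))` of `S¹ × S²`, where `S¹ = ℝ / 2πℤ` is identified
with the unit circle in `ℂ` through `θ ↦ exp (iθ)`. -/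
def twistDiffeo : Diff ((𝓡 1).prod (𝓡 2)) (Circle × S2) where
  toFun p := (p.1, rotS2 p.1 p.2)
  invFun p := (p.1, rotS2 p.1⁻¹ p.2)
  left_inv p := by
    have h := rotS2_rotS2_inv p.1⁻¹ p.2
    rw [inv_inv] at h
    simp [h]
  right_inv p := by simp [rotS2_rotS2_inv]
  contMDiff_toFun := contMDiff_fst.prodMk contMDiff_rotS2
  contMDiff_invFun :=
    contMDiff_fst.prodMk
      (contMDiff_rotS2.comp
        (((contMDiff_inv (𝓡 1) ∞).comp contMDiff_fst).prodMk contMDiff_snd))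

end

/-!
The half turn about a horizontal axis of `S²` conjugates every `r_θ` to `r_θ⁻¹`, so its product with
`S¹`, which is isotopic to the identity, conjugates `r` to `r⁻¹`. Hence `[r]² = 1`.

The manifold `S¹ × S²` is parallelizable. Differentiating an isotopy from the identity to `r` along
the spheres `{z} × S²` at a pole would therefore deform, through families of linearly independent
pairs in `ℝ³` parametrized by the circle, the constant pair of horizontal basis vectors into the
same pair rotated by `z`. After Gram–Schmidt the pairs are orthonormal. Orthonormal pairs in `ℝ³`
are pairs of quaternion generators, and deforming them in the Banach algebra `C(S¹, ℍ)` keeps them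
conjugate. The conjugating function `S¹ → ℍ \ {0}` would give a nowhere vanishing continuous
solution of `w = z (conj w)` on the circle, which does not exist because the argument of `w` is half
that of `z`.
-/

noncomputable section

theorem mk_sq_eq_one_of_conj_eq_inv {Γ : Type*} [Group Γ] {S : Subgroup Γ} [S.Normal] {g a : Γ}
    (hg : g ∈ S) (h : g * a * g⁻¹ = a⁻¹) : (a : Γ ⧸ S) ^ 2 = 1 := by
  have hmk := congrArg (QuotientGroup.mk : Γ → Γ ⧸ S) h
  simpa [(QuotientGroup.eq_one_iff g).2 hg, eq_inv_iff_mul_eq_one, ← sq] using hmk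

section IsotopyToTheIdentity

variable {E : Type*} [NormedAddCommGroup E] [NormedSpace ℝ E]
  {H : Type*} [TopologicalSpace H] {I : ModelWithCorners ℝ E H}
  {M : Type*} [TopologicalSpace M] [ChartedSpace H M]

theorem flow_mem_Diff₀ (φ : ℝ →+ Additive (Diff I M))
    (hφ : ContMDiff (𝓘(ℝ, ℝ).prod I) I ∞ (fun p : ℝ × M => (φ p.1).toMul p.2)) (s : ℝ) :
    (φ s).toMul ∈ Diff₀ I M := by
  have hscale (c : ℝ) : ContMDiff ((𝓡∂ 1).prod I) I ∞
      (fun p : Set.Icc (0 : ℝ) 1 × M => (φ (p.1 * c)).toMul p.2) :=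
    hφ.comp (((contDiff_id.mul contDiff_const).contMDiff.comp
      (contMDiff_subtypeVal_Icc.comp contMDiff_fst)).prodMk contMDiff_snd)
  have hsymm (t : ℝ) : (φ (t * s)).toMul.symm = (φ (t * -s)).toMul := by
    rw [mul_neg, map_neg]
    rfl
  refine ⟨fun t => (φ (t * s)).toMul, hscale s, ?_, by simp, by simp⟩
  simpa only [hsymm] using hscale (-s)

theorem refl_prodCongr_mem_Diff₀ {F : Type*} [NormedAddCommGroup F] [NormedSpace ℝ F]
    {G : Type*} [TopologicalSpace G] (J : ModelWithCorners ℝ F G)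
    (N : Type*) [TopologicalSpace N] [ChartedSpace G N] {f : Diff I M} (hf : f ∈ Diff₀ I M) :
    (Diffeomorph.refl J N ∞).prodCongr f ∈ Diff₀ (J.prod I) (N × M) := by
  obtain ⟨φ, hφ, hφ', h0, rfl⟩ := hf
  refine ⟨fun t => (Diffeomorph.refl J N ∞).prodCongr (φ t), ?_, ?_, ?_, rfl⟩
  · exact (contMDiff_fst.comp contMDiff_snd).prodMk
      (hφ.comp (contMDiff_fst.prodMk (contMDiff_snd.comp contMDiff_snd)))
  · exact (contMDiff_fst.comp contMDiff_snd).prodMk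
      (hφ'.comp (contMDiff_fst.prodMk (contMDiff_snd.comp contMDiff_snd)))
  · dsimp only
    rw [h0]
    rfl

end IsotopyToTheIdentity

section Rotations

open Metric

/-- The action of the linear isometries of `E` on the unit sphere of `E` by diffeomorphisms. -/
def sphereDiffeo {E : Type*} [NormedAddCommGroup E] [InnerProductSpace ℝ E] {n : ℕ}
    [Fact (Module.finrank ℝ E = n + 1)] : (E ≃ₗᵢ[ℝ] E) →* Diff (𝓡 n) (sphere (0 : E) 1) where
  toFun L :=
    { toFun := Set.codRestrict (fun x : sphere (0 : E) 1 => L x) _ fun x => by simp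
      invFun := Set.codRestrict (fun x : sphere (0 : E) 1 => L.symm x) _ fun x => by simp
      left_inv := fun x => Subtype.ext (L.symm_apply_apply x)
      right_inv := fun x => Subtype.ext (L.apply_symm_apply x)
      contMDiff_toFun :=
        (L.contDiff.contMDiff.comp contMDiff_coe_sphere).codRestrict_sphere _
      contMDiff_invFun :=
        (L.symm.contDiff.contMDiff.comp contMDiff_coe_sphere).codRestrict_sphere _ }
  map_one' := rfl
  map_mul' _ _ := rfl

instance fact_finrank_euclideanSpace_three :
    Fact (Module.finrank ℝ (EuclideanSpace ℝ (Fin 3)) = 2 + 1) :=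
  ⟨finrank_euclideanSpace_fin⟩

theorem rotVec_mul (z w : Circle) (x : EuclideanSpace ℝ (Fin 3)) :
    rotVec (z * w) x = rotVec z (rotVec w x) := by
  ext i
  fin_cases i <;> simp [rotVec] <;> ring

theorem norm_rotVec (z : Circle) (x : EuclideanSpace ℝ (Fin 3)) : ‖rotVec z x‖ = ‖x‖ := by
  rw [← sq_eq_sq₀ (norm_nonneg _) (norm_nonneg _)]
  simp only [EuclideanSpace.norm_sq_eq, Fin.sum_univ_three, Real.norm_eq_abs, sq_abs, rotVec,
    Matrix.cons_val]
  linear_combination (x 0 ^ 2 + x 1 ^ 2) * circle_re_sq_add_im_sq z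

/-- The circle action on `ℝ³` by rotations about the `x₃`-axis, as a group of linear isometries. -/
def rotIsometry : Circle →* (EuclideanSpace ℝ (Fin 3) ≃ₗᵢ[ℝ] EuclideanSpace ℝ (Fin 3)) where
  toFun z :=
    { toFun := rotVec z
      invFun := rotVec z⁻¹
      left_inv := fun x => by simpa using rotVec_rotVec_inv z⁻¹ x
      right_inv := rotVec_rotVec_inv z
      map_add' := fun x y => by ext i; fin_cases i <;> simp [rotVec] <;> ring
      map_smul' := fun c x => by ext i; fin_cases i <;> simp [rotVec] <;> ring
      norm_map' := norm_rotVec z }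
  map_one' := by ext x i; fin_cases i <;> simp [rotVec]
  map_mul' z w := LinearIsometryEquiv.ext (rotVec_mul z w)

theorem sphereDiffeo_rotIsometry_mem_Diff₀ (z : Circle) :
    sphereDiffeo (rotIsometry z) ∈ Diff₀ (𝓡 2) S2 := by
  obtain ⟨θ, rfl⟩ := Circle.exp_surjective z
  exact flow_mem_Diff₀ ((sphereDiffeo.comp rotIsometry).toAdditive.comp Circle.expHom)
    (contMDiff_rotS2.comp ((contMDiff_circleExp.comp contMDiff_fst).prodMk contMDiff_snd)) θ

/-- The rotation of `ℝ³` about the `x₁`-axis through the angle `π`, obtained from the one about the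
`x₃`-axis by exchanging the two axes. -/
def halfTurn : EuclideanSpace ℝ (Fin 3) ≃ₗᵢ[ℝ] EuclideanSpace ℝ (Fin 3) :=
  let swapAxes := LinearIsometryEquiv.piLpCongrLeft 2 ℝ ℝ (Equiv.swap (0 : Fin 3) 2)
  swapAxes * rotIsometry (Circle.exp Real.pi) * swapAxes⁻¹

theorem halfTurn_apply (x : EuclideanSpace ℝ (Fin 3)) : halfTurn x = !₂[x 0, -x 1, -x 2] := by
  have hswap : Equiv.swap (0 : Fin 3) 2 1 = 1 := rfl
  ext i
  fin_cases i <;> simp [halfTurn, rotIsometry, rotVec_exp, hswap]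

theorem halfTurn_rotVec (z : Circle) (x : EuclideanSpace ℝ (Fin 3)) :
    halfTurn (rotVec z x) = rotVec z⁻¹ (halfTurn x) := by
  ext i
  fin_cases i <;> simp [halfTurn_apply, rotVec, add_comm]

theorem sphereDiffeo_halfTurn_mem_Diff₀ : sphereDiffeo halfTurn ∈ Diff₀ (𝓡 2) S2 := by
  rw [halfTurn, map_mul, map_mul, map_inv]
  exact (instNormalDiff₀ (𝓡 2) S2).conj_mem _ (sphereDiffeo_rotIsometry_mem_Diff₀ _) _

theorem mk_twistDiffeo_sq :
    (QuotientGroup.mk twistDiffeo : DiffeotopyGroup ((𝓡 1).prod (𝓡 2)) (Circle × S2)) ^ 2 = 1 := by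
  refine mk_sq_eq_one_of_conj_eq_inv
    (refl_prodCongr_mem_Diff₀ (𝓡 1) Circle sphereDiffeo_halfTurn_mem_Diff₀) ?_
  rw [mul_inv_eq_iff_eq_mul]
  ext p : 1
  exact congrArg (Prod.mk p.1) (Subtype.ext (halfTurn_rotVec p.1 p.2))

end Rotations

section QuaternionBases

open Filter Topology

section Algebra

variable {R A : Type*} [CommRing R] [Ring A] [Algebra R A]

/-- The average `1 - i' i - j' j - k' k` of `a' a⁻¹` over the corresponding units `a = 1, i, j, k`
and `a' = 1, i', j', k'` of two quaternion bases, up to the factor `4`. -/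
def quaternionIntertwiner (q q' : QuaternionAlgebra.Basis A (-1 : R) 0 (-1)) : A :=
  1 - q'.i * q.i - q'.j * q.j - q'.k * q.k

/-- Two quaternion bases are conjugate if one unit of `A` conjugates both generators. -/
def QuaternionConj (q q' : QuaternionAlgebra.Basis A (-1 : R) 0 (-1)) : Prop :=
  ∃ u : Aˣ, SemiconjBy (u : A) q.i q'.i ∧ SemiconjBy (u : A) q.j q'.j

variable (q q' : QuaternionAlgebra.Basis A (-1 : R) 0 (-1))

theorem semiconjBy_quaternionIntertwiner_i :
    SemiconjBy (quaternionIntertwiner q q') q.i q'.i := by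
  simp only [SemiconjBy, quaternionIntertwiner, sub_mul, mul_sub, one_mul, mul_one, mul_assoc,
    q.i_mul_i, q.j_mul_i, q.k_mul_i]
  simp only [← mul_assoc, q'.i_mul_i, q'.i_mul_j, q'.i_mul_k]
  simp only [neg_smul, one_smul, zero_smul, add_zero, mul_neg, mul_one, sub_neg_eq_add, mul_zero,
    zero_sub, neg_neg, neg_mul, one_mul]
  abel

theorem semiconjBy_quaternionIntertwiner_j :
    SemiconjBy (quaternionIntertwiner q q') q.j q'.j := by
  simp only [SemiconjBy, quaternionIntertwiner, sub_mul, mul_sub, one_mul, mul_one, mul_assoc,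
    q.i_mul_j, q.j_mul_j, q.k_mul_j]
  simp only [← mul_assoc, q'.j_mul_i, q'.j_mul_j, q'.j_mul_k]
  simp only [neg_smul, one_smul, mul_neg, mul_one, sub_neg_eq_add, zero_smul, zero_sub, neg_mul,
    one_mul, neg_zero, zero_add]
  abel

theorem quaternionIntertwiner_self : quaternionIntertwiner q q = 4 := by
  simp only [quaternionIntertwiner, q.i_mul_i, q.j_mul_j, q.k_mul_k, neg_smul, one_smul, zero_smul,
    add_zero, sub_neg_eq_add, mul_neg, mul_one, neg_neg]
  norm_num

instance : Std.Symm (QuaternionConj (R := R) (A := A)) where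
  symm := fun _ _ ⟨u, hi, hj⟩ => ⟨u⁻¹, hi.units_inv_symm_left, hj.units_inv_symm_left⟩

instance : IsTrans _ (QuaternionConj (R := R) (A := A)) where
  trans := fun _ _ _ ⟨u, hi, hj⟩ ⟨v, hi', hj'⟩ => ⟨v * u, hi'.mul_left hi, hj'.mul_left hj⟩

end Algebra

theorem quaternionConj_of_continuous {A : Type*} [NormedRing A] [HasSummableGeomSeries A]
    [NormedAlgebra ℝ A] {T : Type*} [TopologicalSpace T] [PreconnectedSpace T]
    {q : T → QuaternionAlgebra.Basis A (-1 : ℝ) 0 (-1)}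
    (hi : Continuous fun t => (q t).i) (hj : Continuous fun t => (q t).j) (s t : T) :
    QuaternionConj (q s) (q t) := by
  have hcont (s : T) : Continuous fun t => quaternionIntertwiner (q s) (q t) := by
    simp only [quaternionIntertwiner, ← QuaternionAlgebra.Basis.i_mul_j]
    fun_prop
  have hsymm : Std.Symm fun s t => QuaternionConj (q s) (q t) := ⟨fun _ _ => symm⟩
  refine PreconnectedSpace.induction₂ (fun s t => QuaternionConj (q s) (q t)) (fun s => ?_)
    ⟨fun _ _ _ => _root_.trans⟩ s t
  -- The intertwiner is `4` at `s`, so it is still a unit nearby.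
  have hself : IsUnit (quaternionIntertwiner (q s) (q s)) := by
    rw [quaternionIntertwiner_self, ← map_ofNat (algebraMap ℝ A) 4]
    exact (isUnit_iff_ne_zero.2 four_ne_zero).map _
  filter_upwards [(hcont s).continuousAt.eventually (Units.isOpen.mem_nhds hself)] with t ht
  obtain ⟨u, hu⟩ := ht
  exact ⟨u, hu ▸ semiconjBy_quaternionIntertwiner_i _ _,
    hu ▸ semiconjBy_quaternionIntertwiner_j _ _⟩

end QuaternionBases

section Frames

open Quaternion ComplexConjugate
open scoped InnerProductSpace RealInnerProductSpace

section GramSchmidt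

open InnerProductSpace

variable {𝕜 E ι X : Type*} [RCLike 𝕜] [NormedAddCommGroup E] [InnerProductSpace 𝕜 E]
  [LinearOrder ι] [LocallyFiniteOrderBot ι] [WellFoundedLT ι] [TopologicalSpace X]

theorem continuous_gramSchmidt {b : X → ι → E} (hb : Continuous b)
    (hli : ∀ x, LinearIndependent 𝕜 (b x)) (n : ι) :
    Continuous fun x => gramSchmidt 𝕜 (b x) n := by
  induction n using WellFoundedLT.induction with
  | _ n ih =>
    simp_rw [fun x => gramSchmidt_def 𝕜 (b x) n,
      Submodule.starProjection_singleton]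
    refine ((continuous_apply n).comp hb).sub (continuous_finsetSum _ fun i hi => ?_)
    have hi' := ih i (Finset.mem_Iio.1 hi)
    refine Continuous.smul (Continuous.div (hi'.inner ((continuous_apply n).comp hb))
      (by fun_prop) fun x => ?_) hi'
    simpa using gramSchmidt_ne_zero i (hli x)

theorem continuous_gramSchmidtNormed {b : X → ι → E} (hb : Continuous b)
    (hli : ∀ x, LinearIndependent 𝕜 (b x)) :
    Continuous fun x => gramSchmidtNormed 𝕜 (b x) := by
  refine continuous_pi fun n => ?_
  have hn := continuous_gramSchmidt hb hli n
  refine Continuous.smul ((RCLike.continuous_ofReal.comp hn.norm).inv₀ fun x => ?_) hn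
  simpa using gramSchmidt_ne_zero n (hli x)

theorem gramSchmidtNormed_of_orthonormal {b : ι → E} (hb : Orthonormal 𝕜 b) :
    gramSchmidtNormed 𝕜 b = b := by
  ext1 n
  rw [gramSchmidtNormed, gramSchmidt_of_orthogonal 𝕜 hb.2,
    hb.1 n]
  simp

end GramSchmidt

/-- The identification of `ℝ³` with the purely imaginary quaternions. -/
@[simps]
def imQuaternion (x : EuclideanSpace ℝ (Fin 3)) : ℍ := ⟨0, x 0, x 1, x 2⟩

theorem continuous_imQuaternion : Continuous imQuaternion := by
  have h : Continuous fun x : EuclideanSpace ℝ (Fin 3) => !₂[0, x 0, x 1, x 2] := by fun_prop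
  exact linearIsometryEquivTuple.symm.continuous.comp h

theorem imQuaternion_mul_add_mul (x y : EuclideanSpace ℝ (Fin 3)) :
    imQuaternion x * imQuaternion y + imQuaternion y * imQuaternion x =
      ((-2 * ⟪x, y⟫ : ℝ) : ℍ) := by
  apply Quaternion.ext <;> simp [PiLp.inner_apply, Fin.sum_univ_three] <;> ring

theorem imQuaternion_mul_self (x : EuclideanSpace ℝ (Fin 3)) :
    imQuaternion x * imQuaternion x = ((-⟪x, x⟫ : ℝ) : ℍ) := by
  apply Quaternion.ext <;>
    simp [PiLp.inner_apply, Fin.sum_univ_three, -inner_self_eq_norm_sq_to_K] <;> ring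

variable {X : Type*} [TopologicalSpace X]

/-- The imaginary units of `C(X, ℍ)` given by a continuous family of orthonormal pairs of vectors
in `ℝ³`. -/
def frameQuaternionBasis (e : C(X, Fin 2 → EuclideanSpace ℝ (Fin 3)))
    (he : ∀ x, Orthonormal ℝ (e x)) : QuaternionAlgebra.Basis C(X, ℍ) (-1 : ℝ) 0 (-1) :=
  let unit (m : Fin 2) : C(X, ℍ) :=
    ⟨fun x => imQuaternion (e x m),
      continuous_imQuaternion.comp ((continuous_apply m).comp e.continuous)⟩
  have unit_mul_self (m : Fin 2) : unit m * unit m = (-1 : ℝ) • 1 := by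
    ext1 x
    simp [unit, imQuaternion_mul_self, (he x).1 m]
  { i := unit 0
    j := unit 1
    k := unit 0 * unit 1
    i_mul_i := by rw [unit_mul_self, zero_smul, add_zero]
    j_mul_j := unit_mul_self 1
    i_mul_j := rfl
    j_mul_i := by
      ext1 x
      have h := imQuaternion_mul_add_mul (e x 1) (e x 0)
      rw [(he x).2 one_ne_zero, mul_zero, coe_zero] at h
      rw [zero_smul, zero_sub]
      exact eq_neg_of_add_eq_zero_left h }

theorem exists_quaternion_semiconjBy {T : Type*} [TopologicalSpace T] [PreconnectedSpace T]
    [CompactSpace X] {e : T × X → Fin 2 → EuclideanSpace ℝ (Fin 3)} (he : Continuous e)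
    (hon : ∀ p, Orthonormal ℝ (e p)) (s t : T) :
    ∃ q : X → ℍ, Continuous q ∧ ∀ x, q x ≠ 0 ∧
      ∀ m, SemiconjBy (q x) (imQuaternion (e (s, x) m)) (imQuaternion (e (t, x) m)) := by
  let basis (t : T) : QuaternionAlgebra.Basis C(X, ℍ) (-1 : ℝ) 0 (-1) :=
    frameQuaternionBasis (ContinuousMap.curry ⟨e, he⟩ t) fun x => hon (t, x)
  have hunit (m : Fin 2) : Continuous fun p => imQuaternion (e p m) :=
    continuous_imQuaternion.comp ((continuous_apply m).comp he)
  obtain ⟨u, hi, hj⟩ : QuaternionConj (basis s) (basis t) := quaternionConj_of_continuous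
    (ContinuousMap.curry ⟨_, hunit 0⟩).continuous (ContinuousMap.curry ⟨_, hunit 1⟩).continuous s t
  refine ⟨u.1, u.1.continuous, fun x => ⟨?_, ?_⟩⟩
  · exact left_ne_zero_of_mul_eq_one (congrArg (fun f : C(X, ℍ) => f x) u.mul_inv)
  · rw [Fin.forall_fin_two]
    exact ⟨congrArg (fun f : C(X, ℍ) => f x) hi, congrArg (fun f : C(X, ℍ) => f x) hj⟩

/-- The first two vectors of the standard basis of `ℝ³`. -/
def horizontalFrame (m : Fin 2) : EuclideanSpace ℝ (Fin 3) := EuclideanSpace.single m.castSucc 1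

theorem orthonormal_horizontalFrame : Orthonormal ℝ horizontalFrame :=
  EuclideanSpace.orthonormal_single.comp _ (Fin.castSucc_injective 2)

theorem eq_mul_conj_of_semiconjBy_horizontalFrame {q : ℍ} {z : Circle}
    (h : ∀ m, SemiconjBy q (imQuaternion (horizontalFrame m))
      (imQuaternion (rotVec z (horizontalFrame m)))) :
    q.imI = 0 ∧ q.imJ = 0 ∧ (⟨q.re, q.imK⟩ : ℂ) = z * conj (⟨q.re, q.imK⟩ : ℂ) := by
  obtain ⟨hI, hre, hK, hJ⟩ : -q.imI = -((z : ℂ).re * q.imI) - (z : ℂ).im * q.imJ ∧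
      q.re = (z : ℂ).re * q.re + (z : ℂ).im * q.imK ∧
      q.imK = -((z : ℂ).re * q.imK) + (z : ℂ).im * q.re ∧
      -q.imJ = (z : ℂ).re * q.imJ - (z : ℂ).im * q.imI := by
    simpa [rotVec, horizontalFrame] using Quaternion.ext_iff.1 (h 0)
  obtain ⟨hJ', -, -, hI'⟩ : -q.imJ = (z : ℂ).im * q.imI - (z : ℂ).re * q.imJ ∧
      -q.imK = -((z : ℂ).im * q.re) + (z : ℂ).re * q.imK ∧
      q.re = (z : ℂ).im * q.imK + (z : ℂ).re * q.re ∧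
      q.imI = -((z : ℂ).im * q.imJ) - (z : ℂ).re * q.imI := by
    simpa [rotVec, horizontalFrame] using Quaternion.ext_iff.1 (h 1)
  refine ⟨by linarith, by linarith, Complex.ext ?_ ?_⟩
  · simp only [Complex.mul_re, Complex.conj_re, Complex.conj_im]
    linarith
  · simp only [Complex.mul_im, Complex.conj_re, Complex.conj_im]
    linarith

theorem exists_eq_zero_of_eq_mul_conj {w : Circle → ℂ} (hw : Continuous w)
    (h : ∀ z, w z = z * conj (w z)) : ∃ z, w z = 0 := by
  -- `w (exp (iθ)) exp (-iθ/2)` is real and changes sign over one turn.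
  let u (θ : ℝ) : ℂ := w (Circle.exp θ) * conj (Circle.exp (θ / 2) : ℂ)
  have hu : Continuous fun θ => (u θ).re := by fun_prop
  have hreal (θ : ℝ) : conj (u θ) = u θ := by
    have hexp : (Circle.exp θ : ℂ) = Circle.exp (θ / 2) * Circle.exp (θ / 2) := by
      rw [← Circle.coe_mul, ← Circle.exp_add, add_halves]
    have hunit : (Circle.exp (θ / 2) : ℂ) * conj (Circle.exp (θ / 2) : ℂ) = 1 := by
      rw [← Circle.coe_inv_eq_conj, ← Circle.coe_mul, mul_inv_cancel, Circle.coe_one]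
    have hsemi := h (Circle.exp θ)
    rw [hexp] at hsemi
    simp only [u, map_mul, Complex.conj_conj]
    linear_combination (-(conj (w (Circle.exp θ)) * Circle.exp (θ / 2))) * hunit -
      conj (Circle.exp (θ / 2) : ℂ) * hsemi
  have hends : (u (2 * Real.pi)).re = -(u 0).re := by
    simp [u]
  obtain ⟨θ, hθ⟩ : ∃ θ, (u θ).re = 0 := by
    rcases le_total (u 0).re 0 with h0 | h0
    · exact mem_range_of_exists_le_of_exists_ge hu ⟨0, h0⟩ ⟨2 * Real.pi, by linarith⟩
    · exact mem_range_of_exists_le_of_exists_ge hu ⟨2 * Real.pi, by linarith⟩ ⟨0, h0⟩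
  have huθ : u θ = 0 := Complex.ext hθ (Complex.conj_eq_iff_im.1 (hreal θ))
  exact ⟨Circle.exp θ, by simpa [u] using huθ⟩

theorem not_continuous_frame_of_eq_rotVec {T : Type*} [TopologicalSpace T] [PreconnectedSpace T]
    {b : T × Circle → Fin 2 → EuclideanSpace ℝ (Fin 3)} (hli : ∀ p, LinearIndependent ℝ (b p))
    {s t : T} (hs : ∀ z, b (s, z) = horizontalFrame)
    (ht : ∀ z m, b (t, z) m = rotVec z (horizontalFrame m)) : ¬ Continuous b := by
  intro hb
  obtain ⟨q, hq, hconj⟩ := exists_quaternion_semiconjBy (continuous_gramSchmidtNormed hb hli)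
    (fun p => InnerProductSpace.gramSchmidtNormed_orthonormal (hli p)) s t
  have hrot (z : Circle) : Orthonormal ℝ (b (t, z)) := by
    rw [funext (ht z)]
    exact orthonormal_horizontalFrame.comp_linearIsometryEquiv (rotIsometry z)
  have hfixed (z : Circle) : Orthonormal ℝ (b (s, z)) := by
    rw [hs]
    exact orthonormal_horizontalFrame
  have hcoords (z : Circle) : (q z).imI = 0 ∧ (q z).imJ = 0 ∧
      (⟨(q z).re, (q z).imK⟩ : ℂ) = z * conj (⟨(q z).re, (q z).imK⟩ : ℂ) := by
    refine eq_mul_conj_of_semiconjBy_horizontalFrame fun m => ?_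
    have hm := (hconj z).2 m
    rwa [gramSchmidtNormed_of_orthonormal (hrot z), gramSchmidtNormed_of_orthonormal (hfixed z),
      hs, ht] at hm
  have hw : Continuous fun z => (⟨(q z).re, (q z).imK⟩ : ℂ) :=
    Complex.equivRealProdCLM.symm.continuous.comp
      ((continuous_re.comp hq).prodMk (continuous_imK.comp hq))
  obtain ⟨z, hz⟩ := exists_eq_zero_of_eq_mul_conj hw fun z => (hcoords z).2.2
  obtain ⟨hI, hJ, -⟩ := hcoords z
  obtain ⟨hre, hK⟩ := Complex.ext_iff.1 hz
  exact (hconj z).1 (Quaternion.ext _ _ hre hI hJ hK)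

end Frames

section TrivializedDerivatives

open Metric ComplexConjugate
open scoped InnerProductSpace RealInnerProductSpace

variable {V E : Type*} [NormedAddCommGroup V] [NormedSpace ℝ V]
  [NormedAddCommGroup E] [InnerProductSpace ℝ E]

theorem inner_fderiv_eq_zero_of_norm_eq_one {f : V → E} {y : V} (hf : DifferentiableAt ℝ f y)
    (hnorm : ∀ x, ‖f x‖ = 1) (v : V) : ⟪f y, fderiv ℝ f y v⟫ = 0 := by
  have h := hf.hasFDerivAt.norm_sq
  simp only [hnorm] at h
  simpa using DFunLike.congr_fun (h.unique (hasFDerivAt_const _ _)) v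

theorem continuous_fderiv_of_contMDiff {W E' H T : Type*} [NormedAddCommGroup W]
    [NormedSpace ℝ W] [NormedAddCommGroup E'] [NormedSpace ℝ E'] [TopologicalSpace H]
    {J : ModelWithCorners ℝ E' H} [TopologicalSpace T] [ChartedSpace H T]
    [IsManifold J 1 T] {f : T → V → W}
    (hf : ContMDiff (J.prod 𝓘(ℝ, V)) 𝓘(ℝ, W) 1 (Function.uncurry f)) (y : V) :
    Continuous fun t => fderiv ℝ (f t) y := by
  rw [continuous_iff_continuousAt]
  intro t
  have h := ContMDiffAt.mfderiv (m := 0) f (fun _ => y) (hf (t, y)) contMDiffAt_const (by simp)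
  simp only [mfderiv_eq_fderiv] at h
  have hcoord := inTangentCoordinates_model_space (I := 𝓘(ℝ, V)) (I' := 𝓘(ℝ, W))
    (fun _ => y) (fun t => f t y) (fun t => fderiv ℝ (f t) y) t
  exact (congrArg (ContinuousAt · t) hcoord).mp h.continuousAt

/-- The inclusion of `S¹ × Sⁿ` into `ℂ × E`, where `Sⁿ` is the unit sphere of `E`. -/
def ambient (p : Circle × sphere (0 : E) 1) : ℂ × E := (p.1, p.2)

/-- The map `(w, u) ↦ ⟪i z, w⟫ x + u`, which identifies the tangent space of `S¹ × Sⁿ` at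
`p = (z, x)`, as a subspace of `ℂ × E`, with `E`. -/
def parallelization (p : ℂ × E) : ℂ × E →L[ℝ] E :=
  (innerSL ℝ (Complex.I * p.1) ∘L .fst ℝ ℂ E).smulRight p.2 + .snd ℝ ℂ E

theorem parallelization_apply (p w : ℂ × E) :
    parallelization p w = ⟪Complex.I * p.1, w.1⟫ • p.2 + w.2 := rfl

theorem eq_zero_of_parallelization_eq_zero {p w : ℂ × E} (hp₁ : ‖p.1‖ = 1) (hp₂ : ‖p.2‖ = 1)
    (hw₁ : ⟪p.1, w.1⟫ = 0) (hw₂ : ⟪p.2, w.2⟫ = 0) (h : parallelization p w = 0) : w = 0 := by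
  rw [parallelization_apply] at h
  have hrot : ⟪Complex.I * p.1, w.1⟫ = 0 := by
    simpa [inner_add_right, inner_smul_right, hp₂, hw₂] using congrArg (inner ℝ p.2) h
  have hmul : w.1 * conj p.1 = 0 := by
    rw [Complex.inner] at hw₁ hrot
    refine Complex.ext hw₁ ?_
    rw [map_mul, Complex.conj_I, mul_left_comm] at hrot
    simpa only [neg_mul, Complex.neg_re, Complex.I_mul_re, neg_neg, Complex.zero_im] using hrot
  have hconj : conj p.1 ≠ 0 := by
    rw [ne_eq, map_eq_zero, ← norm_eq_zero, hp₁]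
    exact one_ne_zero
  refine Prod.ext ((mul_eq_zero_iff_right hconj).1 hmul) ?_
  simpa [hrot] using h

/-- The derivative at `y` of a map into `S¹ × Sⁿ`, read in the parallelization of `S¹ × Sⁿ`. -/
def trivializedDeriv (F : V → Circle × sphere (0 : E) 1) (y : V) : V →L[ℝ] E :=
  parallelization (ambient (F y)) ∘L fderiv ℝ (ambient ∘ F) y

theorem trivializedDeriv_mk {z : Circle} {g : V → sphere (0 : E) 1} {g' : V →L[ℝ] E} {y : V}
    (hg : HasFDerivAt (fun x => (g x : E)) g' y) :
    trivializedDeriv (fun x => (z, g x)) y = g' := by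
  have h : HasFDerivAt (ambient ∘ fun x => (z, g x)) (.prod 0 g') y :=
    (hasFDerivAt_const (z : ℂ) y).prodMk hg
  ext v
  simp [trivializedDeriv, h.fderiv, parallelization_apply]

variable {n : ℕ} [Fact (Module.finrank ℝ E = n + 1)]

theorem contMDiff_ambient :
    ContMDiff ((𝓡 1).prod (𝓡 n)) 𝓘(ℝ, ℂ × E) ∞ (ambient (E := E)) :=
  (contMDiff_circle_coe.comp contMDiff_fst).prodMk_space (contMDiff_coe_sphere.comp contMDiff_snd)

theorem mfderiv_ambient_injective (p : Circle × sphere (0 : E) 1) :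
    Function.Injective (mfderiv ((𝓡 1).prod (𝓡 n)) 𝓘(ℝ, ℂ × E) ambient p) := by
  have := finrank_real_complex_fact'
  have hcircle : MDifferentiableAt (𝓡 1) 𝓘(ℝ, ℂ) (fun z : Circle => (z : ℂ)) p.1 :=
    contMDiff_circle_coe.mdifferentiableAt (by simp)
  have hsphere : MDifferentiableAt (𝓡 n) 𝓘(ℝ, E) (fun x : sphere (0 : E) 1 => (x : E)) p.2 :=
    (contMDiff_coe_sphere (m := ∞)).mdifferentiableAt (by simp)
  have h : Function.Injective (mfderiv ((𝓡 1).prod (𝓡 n)) (𝓘(ℝ, ℂ).prod 𝓘(ℝ, E))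
      (Prod.map (fun z : Circle => (z : ℂ)) (fun x : sphere (0 : E) 1 => (x : E))) p) := by
    rw [mfderiv_prodMap hcircle hsphere]
    exact (injective_mvfderiv_subtypeVal_sphere (E := ℂ) p.1).prodMap
      (injective_mvfderiv_subtypeVal_sphere p.2)
  rwa [← modelWithCornersSelf_prod, chartedSpaceSelf_prod] at h

theorem fderiv_ambient_comp {F : V → Circle × sphere (0 : E) 1} {y : V}
    (hF : MDifferentiableAt 𝓘(ℝ, V) ((𝓡 1).prod (𝓡 n)) F y) :
    fderiv ℝ (ambient ∘ F) y =
      (mfderiv ((𝓡 1).prod (𝓡 n)) 𝓘(ℝ, ℂ × E) ambient (F y)).comp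
        (mfderiv 𝓘(ℝ, V) ((𝓡 1).prod (𝓡 n)) F y) := by
  rw [← mfderiv_eq_fderiv]
  exact mfderiv_comp y (contMDiff_ambient.mdifferentiableAt (by simp)) hF

theorem trivializedDeriv_injective {F : V → Circle × sphere (0 : E) 1} {y : V}
    (hF : MDifferentiableAt 𝓘(ℝ, V) ((𝓡 1).prod (𝓡 n)) F y)
    (hinj : Function.Injective (mfderiv 𝓘(ℝ, V) ((𝓡 1).prod (𝓡 n)) F y)) :
    Function.Injective (trivializedDeriv F y) := by
  have hd : DifferentiableAt ℝ (ambient ∘ F) y :=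
    (contMDiff_ambient.mdifferentiableAt (by simp)).comp y hF |>.differentiableAt
  have hd_inj : Function.Injective (fderiv ℝ (ambient ∘ F) y) := by
    rw [fderiv_ambient_comp hF]
    exact (mfderiv_ambient_injective (F y)).comp hinj
  refine (injective_iff_map_eq_zero _).2 fun v hv =>
    (injective_iff_map_eq_zero _).1 hd_inj v ?_
  refine eq_zero_of_parallelization_eq_zero (Circle.norm_coe _) (norm_eq_of_mem_sphere _) ?_ ?_ hv
  · have h := inner_fderiv_eq_zero_of_norm_eq_one hd.fst (fun x => Circle.norm_coe (F x).1) v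
    rwa [hd.hasFDerivAt.fst.fderiv] at h
  · have h := inner_fderiv_eq_zero_of_norm_eq_one hd.snd (fun x => norm_eq_of_mem_sphere (F x).2) v
    rwa [hd.hasFDerivAt.snd.fderiv] at h

theorem continuous_trivializedDeriv_apply {E' H T : Type*} [NormedAddCommGroup E']
    [NormedSpace ℝ E'] [TopologicalSpace H] {J : ModelWithCorners ℝ E' H} [TopologicalSpace T]
    [ChartedSpace H T] [IsManifold J 1 T] {F : T → V → Circle × sphere (0 : E) 1}
    (hF : ContMDiff (J.prod 𝓘(ℝ, V)) ((𝓡 1).prod (𝓡 n)) 1 (Function.uncurry F)) (y v : V) :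
    Continuous fun t => trivializedDeriv (F t) y v := by
  have hf : ContMDiff (J.prod 𝓘(ℝ, V)) 𝓘(ℝ, ℂ × E) 1
      (Function.uncurry fun t => ambient ∘ F t) :=
    (contMDiff_ambient.of_le (by simp)).comp hF
  have hvalue : Continuous fun t => ambient (F t y) :=
    hf.continuous.comp (Continuous.prodMk_left y)
  have hderiv : Continuous fun t => fderiv ℝ (ambient ∘ F t) y v :=
    (continuous_fderiv_of_contMDiff hf y).clm_apply continuous_const
  exact ((continuous_const.mul hvalue.fst).inner hderiv.fst).smul hvalue.snd |>.add hderiv.snd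

end TrivializedDerivatives

section PolarFrames

open Metric

variable {E : Type*} [NormedAddCommGroup E] [InnerProductSpace ℝ E] {v : E} (hv : ‖v‖ = 1)

theorem hasFDerivAt_stereoInvFun_zero :
    HasFDerivAt (fun y => (stereoInvFun hv y : E)) (ℝ ∙ v)ᗮ.subtypeL 0 :=
  hasFDerivAt_stereoInvFunAux_comp_coe v

/-- The parametrization of a neighbourhood of the pole `-v` in `{z} × Sⁿ` by stereographic
projection. -/
def polarSlice (z : Circle) (y : (ℝ ∙ v)ᗮ) : Circle × sphere (0 : E) 1 := (z, stereoInvFun hv y)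

variable {n : ℕ} [Fact (Module.finrank ℝ E = n + 1)]

theorem contMDiff_stereoInvFun :
    ContMDiff 𝓘(ℝ, (ℝ ∙ v)ᗮ) (𝓡 n) ∞ (stereoInvFun hv) :=
  (contDiff_stereoInvFunAux.comp (ℝ ∙ v)ᗮ.subtypeL.contDiff).contMDiff.codRestrict_sphere _

theorem contMDiff_uncurry_polarSlice :
    ContMDiff ((𝓡 1).prod 𝓘(ℝ, (ℝ ∙ v)ᗮ)) ((𝓡 1).prod (𝓡 n)) ∞
      (Function.uncurry (polarSlice hv)) :=
  contMDiff_fst.prodMk ((contMDiff_stereoInvFun hv).comp contMDiff_snd)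

theorem contMDiff_polarSlice (z : Circle) :
    ContMDiff 𝓘(ℝ, (ℝ ∙ v)ᗮ) ((𝓡 1).prod (𝓡 n)) ∞ (polarSlice hv z) :=
  contMDiff_const.prodMk (contMDiff_stereoInvFun hv)

theorem mfderiv_polarSlice_zero_injective (z : Circle) :
    Function.Injective (mfderiv 𝓘(ℝ, (ℝ ∙ v)ᗮ) ((𝓡 1).prod (𝓡 n)) (polarSlice hv z) 0) := by
  have h : HasFDerivAt (ambient ∘ polarSlice hv z) (.prod 0 (ℝ ∙ v)ᗮ.subtypeL) 0 :=
    (hasFDerivAt_const (z : ℂ) _).prodMk (hasFDerivAt_stereoInvFun_zero hv)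
  have hslice : MDifferentiableAt 𝓘(ℝ, (ℝ ∙ v)ᗮ) ((𝓡 1).prod (𝓡 n)) (polarSlice hv z) 0 :=
    (contMDiff_polarSlice hv z).mdifferentiableAt (by simp)
  refine Function.Injective.of_comp (f := mfderiv ((𝓡 1).prod (𝓡 n)) 𝓘(ℝ, ℂ × E) ambient _) ?_
  rw [← ContinuousLinearMap.coe_comp, ← fderiv_ambient_comp hslice, h.fderiv]
  exact fun x y hxy => Subtype.ext (congrArg Prod.snd hxy)

theorem trivializedDeriv_comp_polarSlice_injective
    (f : Diff ((𝓡 1).prod (𝓡 n)) (Circle × sphere (0 : E) 1)) (z : Circle) :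
    Function.Injective (trivializedDeriv (f ∘ polarSlice hv z) 0) := by
  have hf : MDifferentiableAt ((𝓡 1).prod (𝓡 n)) ((𝓡 1).prod (𝓡 n)) f (polarSlice hv z 0) :=
    f.contMDiff.mdifferentiableAt (by simp)
  have hslice : MDifferentiableAt _ ((𝓡 1).prod (𝓡 n)) (polarSlice hv z) 0 :=
    (contMDiff_polarSlice hv z).mdifferentiableAt (by simp)
  refine trivializedDeriv_injective (hf.comp 0 hslice) ?_
  rw [mfderiv_comp 0 hf hslice]
  exact (f.mfderivToContinuousLinearEquiv (by simp) _).injective.comp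
    (mfderiv_polarSlice_zero_injective hv z)

theorem trivializedDeriv_polarSlice_of_linear (L : E ≃ₗᵢ[ℝ] E)
    {f : Circle × sphere (0 : E) 1 → Circle × sphere (0 : E) 1} {z : Circle}
    (hf : ∀ x, f (z, x) = (z, sphereDiffeo (n := n) L x)) :
    trivializedDeriv (f ∘ polarSlice hv z) 0 = L.toContinuousLinearEquiv ∘L (ℝ ∙ v)ᗮ.subtypeL := by
  have hcomp : f ∘ polarSlice hv z = fun y => (z, sphereDiffeo (n := n) L (stereoInvFun hv y)) :=
    funext fun y => hf _
  rw [hcomp]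
  exact trivializedDeriv_mk
    (L.toContinuousLinearEquiv.hasFDerivAt.comp 0 (hasFDerivAt_stereoInvFun_zero hv))

/-- The third vector of the standard basis of `ℝ³`, which spans the axis of the rotations. -/
def rotAxis : EuclideanSpace ℝ (Fin 3) := EuclideanSpace.single 2 1

theorem norm_rotAxis : ‖rotAxis‖ = 1 := by
  simp [rotAxis]

theorem horizontalFrame_mem_orthogonal_rotAxis (m : Fin 2) :
    horizontalFrame m ∈ (ℝ ∙ rotAxis)ᗮ := by
  rw [Submodule.mem_orthogonal_singleton_iff_inner_right]
  fin_cases m <;> simp [horizontalFrame, rotAxis, EuclideanSpace.inner_single_left]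

/-- The images of the two horizontal directions at the south pole of `{z} × S²` under the
derivative of `f`, read in the parallelization of `S¹ × S²`. -/
def polarFrame (f : Circle × S2 → Circle × S2) (z : Circle) (m : Fin 2) :
    EuclideanSpace ℝ (Fin 3) :=
  trivializedDeriv (f ∘ polarSlice norm_rotAxis z) 0
    ⟨horizontalFrame m, horizontalFrame_mem_orthogonal_rotAxis m⟩

theorem linearIndependent_polarFrame (f : Diff ((𝓡 1).prod (𝓡 2)) (Circle × S2)) (z : Circle) :
    LinearIndependent ℝ (polarFrame f z) := by
  have hframe : LinearIndependent ℝ fun m =>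
      (⟨horizontalFrame m, horizontalFrame_mem_orthogonal_rotAxis m⟩ : (ℝ ∙ rotAxis)ᗮ) :=
    .of_comp (ℝ ∙ rotAxis)ᗮ.subtype orthonormal_horizontalFrame.linearIndependent
  exact hframe.map' (trivializedDeriv (f ∘ polarSlice norm_rotAxis z) 0).toLinearMap
    (LinearMap.ker_eq_bot.2 (trivializedDeriv_comp_polarSlice_injective norm_rotAxis f z))

theorem polarFrame_of_linear
    (L : EuclideanSpace ℝ (Fin 3) ≃ₗᵢ[ℝ] EuclideanSpace ℝ (Fin 3))
    {f : Circle × S2 → Circle × S2} {z : Circle}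
    (hf : ∀ x, f (z, x) = (z, sphereDiffeo (n := 2) L x)) (m : Fin 2) :
    polarFrame f z m = L (horizontalFrame m) :=
  DFunLike.congr_fun (trivializedDeriv_polarSlice_of_linear norm_rotAxis L hf) _

theorem continuous_polarFrame {E' H T : Type*} [NormedAddCommGroup E'] [NormedSpace ℝ E']
    [TopologicalSpace H] {J : ModelWithCorners ℝ E' H} [TopologicalSpace T] [ChartedSpace H T]
    [IsManifold J 1 T] {φ : T → Circle × S2 → Circle × S2}
    (hφ : ContMDiff (J.prod ((𝓡 1).prod (𝓡 2))) ((𝓡 1).prod (𝓡 2)) 1 (Function.uncurry φ)) :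
    Continuous fun p : T × Circle => polarFrame (φ p.1) p.2 := by
  have hslice : ContMDiff ((𝓡 1).prod 𝓘(ℝ, (ℝ ∙ rotAxis)ᗮ)) ((𝓡 1).prod (𝓡 2)) 1
      (Function.uncurry (polarSlice norm_rotAxis)) :=
    (contMDiff_uncurry_polarSlice norm_rotAxis).of_le (by simp)
  exact continuous_pi fun m => continuous_trivializedDeriv_apply (J := J.prod (𝓡 1))
    (F := fun p : T × Circle => φ p.1 ∘ polarSlice norm_rotAxis p.2)
    (hφ.comp ((contMDiff_fst.comp contMDiff_fst).prodMk
      (hslice.comp ((contMDiff_snd.comp contMDiff_fst).prodMk contMDiff_snd)))) _ _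

theorem twistDiffeo_not_mem_Diff₀ : twistDiffeo ∉ Diff₀ ((𝓡 1).prod (𝓡 2)) (Circle × S2) := by
  rintro ⟨φ, hφ, -, h0, h1⟩
  refine not_continuous_frame_of_eq_rotVec (fun p => linearIndependent_polarFrame (φ p.1) p.2)
    (s := 0) (t := 1) (fun z => ?_) (fun z m => ?_)
    (continuous_polarFrame (φ := fun t => φ t) (hφ.of_le (by simp)))
  · rw [h0]
    exact funext fun m => polarFrame_of_linear 1 (fun _ => rfl) m
  · rw [h1]
    exact polarFrame_of_linear (rotIsometry z) (fun _ => rfl) m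

end PolarFrames

end

theorem mainTheorem4 :
    orderOf (QuotientGroup.mk twistDiffeo :
      DiffeotopyGroup ((𝓡 1).prod (𝓡 2)) (Circle × S2)) = 2 := by
  exact orderOf_eq_prime mk_twistDiffeo_sq fun h =>
    twistDiffeo_not_mem_Diff₀ ((QuotientGroup.eq_one_iff _).1 h)
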